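/- Let $k\ge 2$ be an integer and let $G$ be a finite simple graph of order $n\ge 6k-5$. For $X\subseteq V(G)$ write $N_G(X)=\bigcup_{x\in X}N_G(x)$, and let the binding number of $G$ be $$bind(G)=\min\left\{\frac{|N_G(X)|}{|X|}:\emptyset\ne X\subseteq V(G),\ N_G(X)\ne V(G)\right\}.$$ A fractional $k$-factor of a graph $H$ is given by a function $h:E(H)\to[0,1]$ (its indicator function) such that $\sum_{e\ni x}h(e)=k$ for every $x\in V(H)$. The graph $H$ is called fractional $k$-covered if it has a fractional $k$-factor and, for every edge $e\in E(H)$, it has a fractional $k$-factor whose indicator function $h$ satisfies $h(e)=1$. The graph $G$ is called fractional ID-$k$-factor-critical covered if $G-I$ is fractional $k$-covered for every independent set $I$ of $G$ (including $I=\emptyset$). If $$bind(G)>\frac{(3k-1)(n-1)}{kn-2k},$$ then $G$ is fractional ID-$k$-factor-critical covered. -/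

import Mathlib

namespace FracGraph

/-- The neighbourhood `N_G(X) = ⋃_{x ∈ X} N_G(x)` of a set of vertices. -/
def nbhd {V : Type*} (G : SimpleGraph V) (X : Set V) : Set V :=
  ⋃ x ∈ X, G.neighborSet x

/-- The ratios `|N_G(X)| / |X|` over the nonempty `X ⊆ V(G)` with `N_G(X) ≠ V(G)`. -/
def bindingRatios {V : Type*} (G : SimpleGraph V) : Set ℝ :=
  {r | ∃ X : Set V, X.Nonempty ∧ nbhd G X ≠ Set.univ ∧
    r = ((nbhd G X).ncard : ℝ) / (X.ncard : ℝ)}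

/-- The binding number of a finite graph. For a graph with at least one vertex the infimum is a
minimum, see `isLeast_bindingNumber`. -/
noncomputable def bindingNumber {V : Type*} (G : SimpleGraph V) : ℝ :=
  sInf (bindingRatios G)

theorem isLeast_bindingNumber {V : Type*} [Finite V] [Nonempty V] (G : SimpleGraph V) :
    IsLeast (bindingRatios G) (bindingNumber G) := by
  have hfin : (bindingRatios G).Finite := by
    refine (Set.finite_range
      (fun X : Set V => ((nbhd G X).ncard : ℝ) / (X.ncard : ℝ))).subset ?_
    rintro r ⟨X, -, -, rfl⟩
    exact ⟨X, rfl⟩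
  have hne : (bindingRatios G).Nonempty := by
    obtain ⟨v⟩ := ‹Nonempty V›
    refine ⟨_, {v}, Set.singleton_nonempty v, ?_, rfl⟩
    intro h
    have hv : v ∈ nbhd G {v} := h ▸ Set.mem_univ v
    simp [nbhd] at hv
  exact ⟨hne.csInf_mem hfin, fun r hr => csInf_le hfin.bddBelow hr⟩

open Classical in
/-- `h` is the indicator function of a fractional `[a,b]`-factor of `G`: `h` maps the edges of `G`
into `[0,1]`, and the sum of `h(e)` over the edges `e` of `G` at `x` lies in `[a,b]` for every
vertex `x`. The values of `h` off the edge set play no role. -/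
def IsFractionalFactor {V : Type*} [Fintype V] (G : SimpleGraph V) (a b : ℕ)
    (h : Sym2 V → ℝ) : Prop :=
  (∀ e ∈ G.edgeSet, 0 ≤ h e ∧ h e ≤ 1) ∧
  ∀ x : V, (a : ℝ) ≤ ∑ e ∈ G.incidenceFinset x, h e ∧
    ∑ e ∈ G.incidenceFinset x, h e ≤ (b : ℝ)

/-- `G` is fractional `[a,b]`-covered: it has a fractional `[a,b]`-factor, and for every edge `e`
it has one whose indicator function is `1` at `e`. (The first clause follows from the second
unless `G` has no edge.) -/
def IsFractionalCovered {V : Type*} [Fintype V] (G : SimpleGraph V) (a b : ℕ) : Prop :=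
  (∃ h : Sym2 V → ℝ, IsFractionalFactor G a b h) ∧
  ∀ e ∈ G.edgeSet, ∃ h : Sym2 V → ℝ, IsFractionalFactor G a b h ∧ h e = 1

open Classical in
/-- `G` is fractional ID-`[a,b]`-factor-critical covered: `G - I` is fractional `[a,b]`-covered
for every independent set `I` of vertices. -/
def IsFractionalIDCriticalCovered {V : Type*} [Fintype V] (G : SimpleGraph V) (a b : ℕ) : Prop :=
  ∀ I : Set V, G.IsIndepSet I → IsFractionalCovered (G.induce Iᶜ) a b

end FracGraph

namespace FracGraph

open Finset

/-! A least-squares argument gives a cut criterion for fractional factors. For covered graphs it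
reduces to k|T| + 2 ≤ k|S| + ∑_{x∈T} d(x) for disjoint S, T in G - I such that some vertex of T has
d < k, where d counts neighbours in G - I - S; the 2 pays for forcing h(e) = 1
(`isFractionalCovered_of_cut_condition`). The binding number is tested on two sets. The
neighbourhood of the non-neighbours of x misses x, so x has fewer than k(n-2)/(3k-1) non-neighbours,
and |I| obeys the same bound. The neighbourhood of V(G - I) \ S misses every vertex of T with d = 0.
The first test suffices if d is positive on T (`cut_bound_of_small_degree`); otherwise the second is
needed too (`cut_bound_of_isolated`). -/

/-! ### Fractional factors from cut conditions. -/

open Classical in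
theorem sum_adj_update {W : Type*} [Fintype W] (H : SimpleGraph W) (h : Sym2 W → ℝ) {u v : W}
    (huv : H.Adj u v) (ε : ℝ) (x : W) :
    ∑ y, (if H.Adj x y then Function.update h s(u, v) (h s(u, v) + ε) s(x, y) else 0)
      = ∑ y, (if H.Adj x y then h s(x, y) else 0)
        + ((if x = u then ε else 0) + (if x = v then ε else 0)) := by
  have hne : u ≠ v := huv.ne
  have : ∀ y, (if H.Adj x y then Function.update h s(u, v) (h s(u, v) + ε) s(x, y) else 0)
      = (if H.Adj x y then h s(x, y) else 0)
        + ((if y = v then (if x = u then ε else 0) else 0)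
          + (if y = u then (if x = v then ε else 0) else 0)) := by
    intro y
    by_cases hxy : s(x, y) = s(u, v)
    · rcases Sym2.eq_iff.1 hxy with ⟨rfl, rfl⟩ | ⟨rfl, rfl⟩
      · simp [huv, hne.symm]
      · simp [huv.symm, Sym2.eq_swap, hne]
    · have h1 : ¬ (x = u ∧ y = v) := fun h => hxy (by rw [h.1, h.2])
      have h2 : ¬ (x = v ∧ y = u) := fun h => hxy (by rw [h.1, h.2, Sym2.eq_swap])
      rw [Function.update_of_ne hxy]
      split_ifs <;> simp_all
  rw [sum_congr rfl fun y _ => this y, sum_add_distrib, sum_add_distrib]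
  simp

open Classical in
/-- A least-squares minimiser of the deficiencies `f x - deg h x` over edge weights `l ≤ h ≤ 1`,
with the first-order condition at every edge. -/
theorem exists_weights_first_order {W : Type*} [Fintype W] (H : SimpleGraph W)
    (f : W → ℝ) (l : Sym2 W → ℝ) (hl : ∀ e, l e ≤ 1) :
    ∃ h : Sym2 W → ℝ, ∃ D : W → ℝ, (∀ e, l e ≤ h e ∧ h e ≤ 1) ∧
      (∀ x, D x = f x - ∑ y, (if H.Adj x y then h s(x, y) else 0)) ∧
      ∀ u v, H.Adj u v → ∀ ε : ℝ, l s(u, v) ≤ h s(u, v) + ε → h s(u, v) + ε ≤ 1 →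
        ε * (D u + D v) ≤ ε ^ 2 := by
  set deg : (Sym2 W → ℝ) → W → ℝ :=
    fun h x => ∑ y, (if H.Adj x y then h s(x, y) else 0) with hdeg
  have hdegc : ∀ x, Continuous fun h => deg h x := by
    intro x
    refine continuous_finsetSum _ fun y _ => ?_
    by_cases hxy : H.Adj x y
    · simpa [hxy] using continuous_apply _
    · simpa [hxy] using continuous_const
  have hcont : Continuous fun h => ∑ x, (f x - deg h x) ^ 2 := by
    refine continuous_finsetSum _ fun x _ => ?_
    exact (continuous_const.sub (hdegc x)).pow 2
  have hcomp : IsCompact (Set.Icc l (fun _ => (1 : ℝ))) := isCompact_Icc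
  obtain ⟨h, hmem, hmin⟩ := hcomp.exists_isMinOn ⟨l, le_refl _, fun e => hl e⟩
    (f := fun h => ∑ x, (f x - deg h x) ^ 2)
    hcont.continuousOn
  have hlo : ∀ e, l e ≤ h e := fun e => hmem.1 e
  have hhi : ∀ e, h e ≤ 1 := fun e => hmem.2 e
  set D : W → ℝ := fun x => f x - deg h x with hD
  refine ⟨h, D, fun e => ⟨hlo e, hhi e⟩, fun x => rfl, ?_⟩
  intro u v huv ε h1 h2
  have hne : u ≠ v := huv.ne
  have hm : Function.update h s(u, v) (h s(u, v) + ε) ∈ Set.Icc l (fun _ => (1 : ℝ)) := by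
    constructor <;> intro e <;> by_cases he : e = s(u, v)
    · subst he; simpa using h1
    · simpa [he] using hlo e
    · subst he; simpa using h2
    · simpa [he] using hhi e
  have hd : ∀ x, deg (Function.update h s(u, v) (h s(u, v) + ε)) x
      = deg h x + ((if x = u then ε else 0) + (if x = v then ε else 0)) :=
    sum_adj_update H h huv ε
  -- Moving one edge by ε changes the sum of squares by 2ε² - 2ε(D u + D v), which minimality makes
  -- nonnegative.
  have key := isMinOn_iff.1 hmin _ hm
  have hexp : ∀ x, (f x - deg (Function.update h s(u, v) (h s(u, v) + ε)) x) ^ 2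
      = (f x - deg h x) ^ 2 + ((if x = u then ε ^ 2 - 2 * ε * D u else 0)
        + (if x = v then ε ^ 2 - 2 * ε * D v else 0)) := by
    intro x
    rw [hd x]
    by_cases hu : x = u
    · subst hu; simp only [hD, hne, if_true, if_false]; ring
    · by_cases hv : x = v
      · subst hv; simp only [hD, hu, if_true, if_false]; ring
      · simp [hu, hv]
  simp only [hexp] at key
  rw [sum_add_distrib, sum_add_distrib] at key
  simp only [sum_ite_eq', mem_univ, if_true] at key
  linarith

open Classical in
/-- Sufficiency in the fractional factor theorem with lower bounds `l` on the edge weights. -/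
theorem exists_weights_of_cut_condition {W : Type*} [Fintype W] (H : SimpleGraph W)
    (f : W → ℝ) (l : Sym2 W → ℝ) (hl : ∀ e, 0 ≤ l e ∧ l e ≤ 1)
    (hcut : ∀ S T : Finset W, Disjoint S T →
      0 ≤ ∑ x ∈ S, f x - ∑ x ∈ T, f x
        + ∑ x ∈ T, ∑ y ∈ Sᶜ, (if H.Adj x y then (1 : ℝ) else 0)
        - ∑ x ∈ S, ∑ y ∈ Tᶜ, (if H.Adj x y then l s(x, y) else 0)) :
    ∃ h : Sym2 W → ℝ, (∀ e, l e ≤ h e ∧ h e ≤ 1) ∧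
      ∀ x, ∑ y, (if H.Adj x y then h s(x, y) else 0) = f x := by
  obtain ⟨h, D, hh, hD, hvar⟩ := exists_weights_first_order H f l fun e => (hl e).2
  have hlo : ∀ e, l e ≤ h e := fun e => (hh e).1
  have hhi : ∀ e, h e ≤ 1 := fun e => (hh e).2
  have hpos : ∀ u v, H.Adj u v → 0 < D u + D v → h s(u, v) = 1 := by
    intro u v huv hs
    by_contra hne
    have hlt : h s(u, v) < 1 := lt_of_le_of_ne (hhi _) hne
    -- The first bound keeps the weight at most 1; the half gives ε² < ε(D u + D v), against `hvar`.
    set ε := min (1 - h s(u, v)) ((D u + D v) / 2) with hε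
    have hε0 : 0 < ε := lt_min (by linarith) (by linarith)
    have e1 : ε ≤ 1 - h s(u, v) := min_le_left _ _
    have e2 : ε ≤ (D u + D v) / 2 := min_le_right _ _
    have := hvar u v huv ε (by linarith [hlo s(u, v)]) (by linarith)
    nlinarith
  have hneg : ∀ u v, H.Adj u v → D u + D v < 0 → h s(u, v) = l s(u, v) := by
    intro u v huv hs
    by_contra hne
    have hlt : l s(u, v) < h s(u, v) := lt_of_le_of_ne (hlo _) (Ne.symm hne)
    set ε := min (h s(u, v) - l s(u, v)) (-(D u + D v) / 2) with hε
    have hε0 : 0 < ε := lt_min (by linarith) (by linarith)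
    have e1 : ε ≤ h s(u, v) - l s(u, v) := min_le_left _ _
    have e2 : ε ≤ -(D u + D v) / 2 := min_le_right _ _
    have := hvar u v huv (-ε) (by linarith) (by linarith [hhi s(u, v)])
    nlinarith
  refine ⟨h, fun e => ⟨hlo e, hhi e⟩, ?_⟩
  -- Edges from T to Sᶜ have weight 1 and edges from S to Tᶜ weight `l`, so the cut expression
  -- equals ∑_S D - ∑_T D, which is at most 0; the cut condition forces D = 0.
  set S : Finset W := univ.filter fun x => D x < 0 with hS
  set T : Finset W := univ.filter fun x => 0 < D x with hT
  have hST : Disjoint S T := by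
    rw [Finset.disjoint_left]
    intro x hx hx'
    simp only [hS, hT, mem_filter, mem_univ, true_and] at hx hx'
    linarith
  have hdT : ∀ x ∈ T, f x - D x = ∑ y ∈ Sᶜ, (if H.Adj x y then (1 : ℝ) else 0)
      + ∑ y ∈ S, (if H.Adj x y then h s(x, y) else 0) := by
    intro x hx
    rw [hD, sub_sub_cancel]
    rw [← sum_compl_add_sum S]
    congr 1
    refine sum_congr rfl fun y hy => ?_
    simp only [hS, hT, mem_compl, mem_filter, mem_univ, true_and, not_lt] at hx hy
    split_ifs with hxy
    · exact hpos x y hxy (by linarith)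
    · rfl
  have hdS : ∀ x ∈ S, f x - D x = ∑ y ∈ Tᶜ, (if H.Adj x y then l s(x, y) else 0)
      + ∑ y ∈ T, (if H.Adj x y then h s(x, y) else 0) := by
    intro x hx
    rw [hD, sub_sub_cancel]
    rw [← sum_compl_add_sum T]
    congr 1
    refine sum_congr rfl fun y hy => ?_
    simp only [hS, hT, mem_compl, mem_filter, mem_univ, true_and, not_lt] at hx hy
    split_ifs with hxy
    · exact hneg x y hxy (by linarith)
    · rfl
  have hswap : ∑ x ∈ T, ∑ y ∈ S, (if H.Adj x y then h s(x, y) else 0)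
      = ∑ x ∈ S, ∑ y ∈ T, (if H.Adj x y then h s(x, y) else 0) := by
    rw [sum_comm]
    refine sum_congr rfl fun x _ => sum_congr rfl fun y _ => ?_
    rw [Sym2.eq_swap, H.adj_comm]
  have hsT := sum_congr rfl hdT
  have hsS := sum_congr rfl hdS
  rw [sum_sub_distrib, sum_add_distrib] at hsT hsS
  have hc := hcut S T hST
  have hTn : 0 ≤ ∑ x ∈ T, D x := sum_nonneg fun x hx => by
    simp only [hT, mem_filter, mem_univ, true_and] at hx; exact hx.le
  have hSn : ∑ x ∈ S, D x ≤ 0 := sum_nonpos fun x hx => by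
    simp only [hS, mem_filter, mem_univ, true_and] at hx; exact hx.le
  have hT0 : ∑ x ∈ T, D x = 0 := by linarith
  have hS0 : ∑ x ∈ S, D x = 0 := by linarith
  intro x
  have hDx : D x = 0 := by
    rcases lt_trichotomy (D x) 0 with hx | hx | hx
    · have hxS : x ∈ S := by simpa [hS] using hx
      exact (sum_eq_zero_iff_of_nonpos (fun z hz => by
        simp only [hS, mem_filter, mem_univ, true_and] at hz; exact hz.le)).1 hS0 x hxS
    · exact hx
    · have hxT : x ∈ T := by simpa [hT] using hx
      exact (sum_eq_zero_iff_of_nonneg (fun z hz => by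
        simp only [hT, mem_filter, mem_univ, true_and] at hz; exact hz.le)).1 hT0 x hxT
  rw [hD] at hDx
  linarith

open Classical in
theorem sum_incidenceFinset_eq {W : Type*} [Fintype W] (H : SimpleGraph W) (h : Sym2 W → ℝ)
    (x : W) : ∑ e ∈ H.incidenceFinset x, h e = ∑ y, (if H.Adj x y then h s(x, y) else 0) := by
  rw [← sum_filter]
  symm
  refine sum_bij (fun y _ => s(x, y)) ?_ ?_ ?_ ?_
  · intro y hy
    simpa using hy
  · intro y _ z _ hyz
    exact Sym2.congr_right.1 hyz
  · intro e he
    induction e with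
    | h a b =>
      rw [SimpleGraph.mem_incidenceFinset, SimpleGraph.mk'_mem_incidenceSet_iff] at he
      obtain ⟨hab, rfl | rfl⟩ := he
      · exact ⟨b, by simpa using hab, rfl⟩
      · exact ⟨a, by simpa using hab.symm, Sym2.eq_swap⟩
  · intros; rfl

open Classical in
/-- The cut condition, with slack `2` as soon as some vertex of `T` has few neighbours off `S`,
makes a graph fractional `k`-covered. -/
theorem isFractionalCovered_of_cut_condition {W : Type*} [Fintype W] (H : SimpleGraph W) (k : ℕ)
    (hk : 2 ≤ k)
    (hcut : ∀ S T : Finset W, Disjoint S T →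
      (∃ x ∈ T, #{y | y ∉ S ∧ H.Adj x y} < k) →
      k * #T + 2 ≤ k * #S + ∑ x ∈ T, #{y | y ∉ S ∧ H.Adj x y}) :
    IsFractionalCovered H k k := by
  -- The sum runs over ordered pairs, so the indicator of one edge has total 2.
  have main : ∀ l : Sym2 W → ℝ, (∀ e, 0 ≤ l e ∧ l e ≤ 1) →
      (∑ x, ∑ y, l s(x, y) ≤ 2) → ∃ h : Sym2 W → ℝ, IsFractionalFactor H k k h ∧
        ∀ e, l e ≤ h e ∧ h e ≤ 1 := by
    intro l hl hl2
    obtain ⟨h, h1, h2⟩ := exists_weights_of_cut_condition H (fun _ => (k : ℝ)) l hl (by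
      intro S T hST
      have hd : ∀ x, ∑ y ∈ Sᶜ, (if H.Adj x y then (1 : ℝ) else 0)
          = (#{y | y ∉ S ∧ H.Adj x y} : ℝ) := by
        intro x
        rw [sum_boole]
        congr 2
        ext y
        simp
      simp only [hd, sum_const, nsmul_eq_mul]
      have hle : ∀ x y, (if H.Adj x y then l s(x, y) else 0) ≤ l s(x, y) := by
        intro x y
        split_ifs
        · exact le_rfl
        · exact (hl _).1
      have hε : ∑ x ∈ S, ∑ y ∈ Tᶜ, (if H.Adj x y then l s(x, y) else 0) ≤ 2 := by
        refine le_trans ?_ hl2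
        refine le_trans (sum_le_sum fun x _ => le_trans (sum_le_sum fun y _ => hle x y)
          (sum_le_univ_sum_of_nonneg fun y => (hl _).1)) ?_
        exact sum_le_univ_sum_of_nonneg fun x => sum_nonneg fun y _ => (hl _).1
      by_cases hx : ∃ x ∈ T, #{y | y ∉ S ∧ H.Adj x y} < k
      · have := hcut S T hST hx
        have h' : (k : ℝ) * #T + 2 ≤ k * #S + ∑ x ∈ T, (#{y | y ∉ S ∧ H.Adj x y} : ℝ) := by
          exact_mod_cast this
        linarith
      -- Only the `l` term can hurt here: it is empty for S = ∅, and otherwise k|S| ≥ 2 absorbs it.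
      · push Not at hx
        have h' : (#T : ℝ) * k ≤ ∑ x ∈ T, (#{y | y ∉ S ∧ H.Adj x y} : ℝ) := by
          rw [← nsmul_eq_mul]
          exact card_nsmul_le_sum _ _ _ fun x hxT => by exact_mod_cast hx x hxT
        rcases S.eq_empty_or_nonempty with rfl | hS
        · simp only [card_empty, sum_empty, Nat.cast_zero]
          linarith
        · have hs : (1 : ℝ) ≤ #S := by exact_mod_cast hS.card_pos
          have hk' : (2 : ℝ) ≤ k := by exact_mod_cast hk
          nlinarith)
    refine ⟨h, ⟨fun e _ => ⟨(hl e).1.trans (h1 e).1, (h1 e).2⟩, fun x => ?_⟩, h1⟩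
    have hs : ∑ e ∈ H.incidenceFinset x, h e = k := (sum_incidenceFinset_eq H h x).trans (h2 x)
    exact ⟨hs.ge, hs.le⟩
  constructor
  · obtain ⟨h, hh, -⟩ := main (fun _ => 0) (by simp) (by simp)
    exact ⟨h, hh⟩
  · intro e _
    obtain ⟨h, hh, he⟩ := main (fun e' => if e' = e then 1 else 0)
      (fun e' => by split_ifs <;> simp) (by
        induction e with
        | h u v =>
          have : ∀ x y, (if s(x, y) = s(u, v) then (1 : ℝ) else 0)
              ≤ (if y = v then (if x = u then 1 else 0) else 0)
                + (if y = u then (if x = v then 1 else 0) else 0) := by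
            intro x y
            split_ifs <;> simp_all
          refine le_trans (sum_le_sum fun x _ => sum_le_sum fun y _ => this x y) ?_
          simp only [sum_add_distrib, sum_ite_eq', mem_univ, if_true]
          norm_num)
    refine ⟨h, hh, le_antisymm (he e).2 ?_⟩
    simpa using (he e).1

/-! ### Consequences of a large binding number. -/

/-- A lower bound on the binding number, cleared of denominators. -/
theorem card_mul_lt_of_lt_bindingNumber {V : Type*} [Fintype V] (G : SimpleGraph V) {p q : ℕ}
    (hq : 0 < q) (hb : (p : ℝ) / q < bindingNumber G) {X : Set V} (hX : X.Nonempty)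
    (hN : nbhd G X ≠ Set.univ) : p * X.ncard < q * (nbhd G X).ncard := by
  have : Nonempty V := ⟨hX.some⟩
  have h1 := (isLeast_bindingNumber G).2 ⟨X, hX, hN, rfl⟩
  have hXc : 0 < X.ncard := (Set.ncard_pos (Set.toFinite X)).2 hX
  have h2 := hb.trans_le h1
  rw [div_lt_div_iff₀ (by exact_mod_cast hq) (by exact_mod_cast hXc)] at h2
  have h3 : p * X.ncard < (nbhd G X).ncard * q := by exact_mod_cast h2
  rwa [mul_comm q]

/-- The non-neighbours of a vertex are few when the binding number is large. -/
theorem card_not_adj_mul_lt_of_lt_bindingNumber {V : Type*} [Fintype V] (G : SimpleGraph V)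
    {p q : ℕ} (hq : 0 < q) (hb : (p : ℝ) / q < bindingNumber G) (x : V) :
    p * {y | ¬ G.Adj x y}.ncard < q * (Fintype.card V - 1) := by
  have hx : x ∉ nbhd G {y | ¬ G.Adj x y} := by
    simp only [nbhd, Set.mem_iUnion, not_exists]
    intro y hy hxy
    exact hy hxy.symm
  have h := card_mul_lt_of_lt_bindingNumber G hq hb (X := {y | ¬ G.Adj x y}) ⟨x, by simp⟩
    (fun h => hx (h ▸ Set.mem_univ x))
  refine h.trans_le (Nat.mul_le_mul_left _ ?_)
  have h1 : nbhd G {y | ¬ G.Adj x y} ⊆ {x}ᶜ := fun z hz hzx => hx (hzx ▸ hz)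
  have h2 := Set.ncard_le_ncard h1 (Set.toFinite _)
  rwa [Set.ncard_compl, Set.ncard_singleton, Nat.card_eq_fintype_card] at h2

/-! ### The integer inequalities. -/

/-- Here i = |I|, m = |G - I|, and y counts the vertices of T isolated off S. Substituting t ≤ m - s
and `hX` leaves a bound linear in y, worst at y = 1. -/
theorem cut_bound_of_isolated {k n i m s t y d : ℤ} (hk : 2 ≤ k) (hn : 6 * k - 5 ≤ n)
    (hm : m = n - i) (hi : (3 * k - 1) * i < k * (n - 2)) (hst : s + t ≤ m) (hy : 1 ≤ y)
    (hX : (3 * k - 1) * (n - 1) * (m - s) < k * (n - 2) * (n - y)) (hd : t - y ≤ d) :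
    k * t + 2 ≤ k * s + d := by
  have hn7 : 7 ≤ n := by linarith
  have hB : 0 < (3 * k - 1) * (n - 1) := mul_pos (by linarith) (by linarith)
  suffices h : 0 ≤ k * m - (2 * k - 1) * (m - s) - y - 2 by nlinarith
  suffices h : 0 ≤ (3 * k - 1) * (n - 1) * (k * m - (2 * k - 1) * (m - s) - y - 2) from
    nonneg_of_mul_nonneg_right h hB
  have h1 : (2 * k - 1) * ((3 * k - 1) * (n - 1) * (m - s))
      ≤ (2 * k - 1) * (k * (n - 2) * (n - y)) :=
    mul_le_mul_of_nonneg_left hX.le (by linarith)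
  -- The coefficient of y; it vanishes at k = 2, n = 7.
  have h2 : 0 ≤ (2 * k - 1) * k * (n - 2) - (3 * k - 1) * (n - 1) := by
    have : 0 ≤ (2 * k ^ 2 - 4 * k + 1 - 1) * (n - 7) :=
      mul_nonneg (by nlinarith) (by linarith)
    nlinarith
  have h3 : 0 ≤ ((2 * k - 1) * k * (n - 2) - (3 * k - 1) * (n - 1)) * (y - 1) :=
    mul_nonneg h2 (by linarith)
  -- By the bound on i, the right side is at least (3k-1)(2k-3).
  have h4 : 0 ≤ (3 * k - 1) * (k * m - 3) - (2 * k - 1) * k * (n - 2) := by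
    subst hm
    have : k * ((3 * k - 1) * i) ≤ k * (k * (n - 2)) :=
      mul_le_mul_of_nonneg_left hi.le (by linarith)
    nlinarith
  have h5 := mul_nonneg (show 0 ≤ n - 1 by linarith) h4
  linarith

/-- Here h is the least degree off S in T, attained at a vertex with p non-neighbours (itself
included). Eliminating t and then s leaves a bound in i, p, h. -/
theorem cut_bound_of_small_degree {k n i m s t p h d : ℤ} (hk : 2 ≤ k) (hn : 6 * k - 5 ≤ n)
    (hm : m = n - i) (hi : (3 * k - 1) * i < k * (n - 2)) (hp : (3 * k - 1) * p < k * (n - 2))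
    (hst : s + t ≤ m) (hh : 1 ≤ h) (hhk : h < k) (hs : m ≤ p + s + h) (hd : h * t ≤ d) :
    k * t + 2 ≤ k * s + d := by
  have hB : 0 < 3 * k - 1 := by linarith
  have h1 : 0 ≤ (k - h) * (m - s - t) := mul_nonneg (by linarith) (by linarith)
  have h2 : 0 ≤ (2 * k - h) * (p + s + h - m) := mul_nonneg (by linarith) (by linarith)
  suffices h : 0 ≤ k * m - (2 * k - h) * (p + h) - 2 by linarith
  suffices h : 0 ≤ (3 * k - 1) * (k * m - (2 * k - h) * (p + h) - 2) from
    nonneg_of_mul_nonneg_right h hB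
  -- The -1 comes from integrality; at h = 1 the estimate leaves no slack.
  have h3 : 0 ≤ k * (k * (n - 2) - 1 - (3 * k - 1) * i) := mul_nonneg (by linarith) (by linarith)
  have h4 : 0 ≤ (2 * k - h) * (k * (n - 2) - 1 - (3 * k - 1) * p) :=
    mul_nonneg (by linarith) (by linarith)
  -- For h ≥ 2 this is at least 4k - 4. At h = 1 it can be negative (k = 2, n = 7), but its factor h
  -- - 1 vanishes.
  have h5 : 0 ≤ k * (n - 2) - 1 - (3 * k - 1) * (2 * k - h - 1)
      ∨ h = 1 := by
    rcases hh.eq_or_lt with h1 | h1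
    · exact Or.inr h1.symm
    · left
      nlinarith
  have h6 : 0 ≤ (h - 1) * (k * (n - 2) - 1 - (3 * k - 1) * (2 * k - h - 1)) := by
    rcases h5 with h5 | rfl
    · exact mul_nonneg (by linarith) h5
    · simp
  subst hm
  linarith

end FracGraph

/-! ### The cut condition in G - I. -/

open FracGraph Finset in
open Classical in
theorem FracGraph.induce_compl_cut_condition {V : Type*} [Fintype V] (G : SimpleGraph V) (k : ℕ)
    (hk : 2 ≤ k) (hn : 6 * k - 5 ≤ Fintype.card V)
    (hbind : (((3 * k - 1) * (Fintype.card V - 1) : ℕ) : ℝ) / ((k * (Fintype.card V - 2) : ℕ) : ℝ)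
      < bindingNumber G)
    (I : Set V) (hI : G.IsIndepSet I) (S T : Finset ↥Iᶜ) (hST : Disjoint S T)
    (hx : ∃ x ∈ T, #{y | y ∉ S ∧ (G.induce Iᶜ).Adj x y} < k) :
    k * #T + 2 ≤ k * #S + ∑ x ∈ T, #{y | y ∉ S ∧ (G.induce Iᶜ).Adj x y} := by
  set n := Fintype.card V with hndef
  have hn7 : 7 ≤ n := by omega
  have hq : 0 < k * (n - 2) := Nat.mul_pos (by omega) (by omega)
  -- The factor n - 1 in the binding bound cancels.
  have hnon : ∀ x, (3 * k - 1) * {y | ¬ G.Adj x y}.ncard < k * (n - 2) := by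
    intro x
    have := card_not_adj_mul_lt_of_lt_bindingNumber G hq hbind x
    rw [mul_right_comm] at this
    exact lt_of_mul_lt_mul_right this (Nat.zero_le _)
  have hIc : (3 * k - 1) * I.ncard < k * (n - 2) := by
    rcases I.eq_empty_or_nonempty with rfl | ⟨x, hx⟩
    · simpa using hq
    · refine lt_of_le_of_lt (Nat.mul_le_mul_left _ (Set.ncard_le_ncard ?_ (Set.toFinite _)))
        (hnon x)
      intro y hy hxy
      exact hI hx hy hxy.ne hxy
  have hm : Fintype.card ↥Iᶜ + I.ncard = n := by
    rw [← Nat.card_eq_fintype_card, Nat.card_coe_set_eq, add_comm, Set.ncard_add_ncard_compl,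
      Nat.card_eq_fintype_card]
  have hst : #S + #T ≤ Fintype.card ↥Iᶜ := by
    rw [← card_union_of_disjoint hST]
    exact card_le_univ _
  set d : ↥Iᶜ → ℕ := fun x => #{y | y ∉ S ∧ (G.induce Iᶜ).Adj x y} with hd
  obtain ⟨x₀, hx₀, hx₀k⟩ := hx
  obtain ⟨x, hxT, hmin⟩ := T.exists_min_image d ⟨x₀, hx₀⟩
  have hdk : d x < k := (hmin x₀ hx₀).trans_lt hx₀k
  have hkZ : (2 : ℤ) ≤ k := by exact_mod_cast hk
  have hnZ : 6 * (k : ℤ) - 5 ≤ n := by omega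
  have hmZ : (Fintype.card ↥Iᶜ : ℤ) = n - I.ncard := by omega
  have c3 : ((3 * k - 1 : ℕ) : ℤ) = 3 * k - 1 := by omega
  have c2 : ((n - 2 : ℕ) : ℤ) = n - 2 := by omega
  have c1 : ((n - 1 : ℕ) : ℤ) = n - 1 := by omega
  have hIZ : (3 * (k : ℤ) - 1) * I.ncard < k * (n - 2) := by
    rw [← c3, ← c2]; exact_mod_cast hIc
  have hstZ : (#S : ℤ) + #T ≤ Fintype.card ↥Iᶜ := by exact_mod_cast hst
  suffices h : (k : ℤ) * #T + 2 ≤ k * #S + ((∑ x ∈ T, d x : ℕ) : ℤ) by exact_mod_cast h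
  rcases Nat.eq_zero_or_pos (d x) with h0 | hpos
  · set Y : Finset ↥Iᶜ := T.filter fun z => d z = 0 with hY
    have hYpos : 1 ≤ #Y := card_pos.2 ⟨x, by simp [hY, hxT, h0]⟩
    set X : Finset V := Sᶜ.map (Function.Embedding.subtype _) with hX
    have hdisj : ∀ z ∈ Y, (z : V) ∉ nbhd G (X : Set V) := by
      intro z hz hzN
      simp only [nbhd, Set.mem_iUnion, SimpleGraph.mem_neighborSet] at hzN
      obtain ⟨w, hw, hwz⟩ := hzN
      obtain ⟨w', hw', rfl⟩ := mem_map.1 (mem_coe.1 hw)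
      have hz0 : d z = 0 := (mem_filter.1 hz).2
      rw [hd, card_eq_zero, filter_eq_empty_iff] at hz0
      exact hz0 (mem_univ w') ⟨by simpa using hw', hwz.symm⟩
    have hxY : x ∈ Y := by simp [hY, hxT, h0]
    have hXne : (X : Set V).Nonempty :=
      ⟨x, mem_coe.2 (mem_map.2 ⟨x, by
        simpa using fun h => Finset.disjoint_left.1 hST h hxT, rfl⟩)⟩
    have hb := card_mul_lt_of_lt_bindingNumber G hq hbind hXne
      (fun h => hdisj x hxY (h ▸ Set.mem_univ _))
    have hNle : (nbhd G (X : Set V)).ncard + #Y ≤ n := by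
      have hsub : nbhd G (X : Set V) ⊆ ((Y.map (Function.Embedding.subtype _) : Finset V) : Set V)ᶜ := by
        intro v hv hvY
        obtain ⟨z, hz, rfl⟩ := mem_map.1 (mem_coe.1 hvY)
        exact hdisj z hz hv
      have h1 := Set.ncard_le_ncard hsub (Set.toFinite _)
      have h2 := Set.ncard_add_ncard_compl
        ((Y.map (Function.Embedding.subtype _) : Finset V) : Set V)
      rw [Set.ncard_coe_finset, card_map, Nat.card_eq_fintype_card] at h2
      omega
    rw [Set.ncard_coe_finset, hX, card_map, card_compl] at hb
    have cS : ((Fintype.card ↥Iᶜ - #S : ℕ) : ℤ) = Fintype.card ↥Iᶜ - #S := by omega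
    have hbZ : (3 * (k : ℤ) - 1) * (n - 1) * (Fintype.card ↥Iᶜ - #S) < k * (n - 2) * (n - #Y) := by
      refine lt_of_lt_of_le (b := (k : ℤ) * (n - 2) * (nbhd G (X : Set V)).ncard) ?_ ?_
      · rw [← c3, ← c2, ← c1, ← cS]; exact_mod_cast hb
      · refine mul_le_mul_of_nonneg_left (by omega) ?_
        rw [← c2]; positivity
    have hdsum : (#T : ℤ) - #Y ≤ ((∑ x ∈ T, d x : ℕ) : ℤ) := by
      -- Each vertex of T outside Y contributes at least 1.
      have h1 : #T ≤ ∑ z ∈ T, (d z + if d z = 0 then 1 else 0) := by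
        rw [card_eq_sum_ones]
        refine sum_le_sum fun z _ => ?_
        split_ifs <;> omega
      rw [sum_add_distrib, ← card_filter] at h1
      change #T ≤ _ + #Y at h1
      omega
    exact cut_bound_of_isolated hkZ hnZ hmZ hIZ hstZ (by exact_mod_cast hYpos) hbZ hdsum
  · have hpZ : (3 * (k : ℤ) - 1) * ({y | ¬ G.Adj x y}.ncard : ℕ) < k * (n - 2) := by
      rw [← c3, ← c2]; exact_mod_cast hnon x
    have hcover : Fintype.card ↥Iᶜ ≤ {y | ¬ G.Adj x y}.ncard + #S + d x := by
      have h1 : (univ : Finset ↥Iᶜ) ⊆ ({y | ¬ (G.induce Iᶜ).Adj x y} : Finset ↥Iᶜ) ∪ S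
          ∪ ({y | y ∉ S ∧ (G.induce Iᶜ).Adj x y} : Finset ↥Iᶜ) := by
        intro y _
        simp only [mem_union, mem_filter, mem_univ, true_and]
        tauto
      have h2 := (card_le_card h1).trans ((card_union_le _ _).trans
        (Nat.add_le_add_right (card_union_le _ _) _))
      have h3 : #({y | ¬ (G.induce Iᶜ).Adj x y} : Finset ↥Iᶜ) ≤ {y | ¬ G.Adj x y}.ncard := by
        rw [← card_map (Function.Embedding.subtype _), ← Set.ncard_coe_finset]
        refine Set.ncard_le_ncard ?_ (Set.toFinite _)
        intro v hv
        obtain ⟨w, hw, rfl⟩ := mem_map.1 (mem_coe.1 hv)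
        exact (mem_filter.1 hw).2
      rw [card_univ] at h2
      simp only [hd]
      omega
    have hdsum : d x * #T ≤ ∑ z ∈ T, d z := by
      rw [mul_comm, ← smul_eq_mul]
      exact card_nsmul_le_sum _ _ _ hmin
    exact cut_bound_of_small_degree (h := (d x : ℤ)) hkZ hnZ hmZ hIZ hpZ hstZ (by exact_mod_cast hpos)
      (by exact_mod_cast hdk) (by exact_mod_cast hcover) (by exact_mod_cast hdsum)

theorem corollary1 {V : Type*} [Fintype V] (G : SimpleGraph V) (k n : ℕ)
    (hk : 2 ≤ k) (hcard : Fintype.card V = n) (hn : 6 * k - 5 ≤ n)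
    (hbind : FracGraph.bindingNumber G >
      ((3 * (k : ℝ) - 1) * ((n : ℝ) - 1)) / ((k : ℝ) * (n : ℝ) - 2 * (k : ℝ))) :
    FracGraph.IsFractionalIDCriticalCovered G k k := by
  classical
  subst hcard
  intro I hI
  refine FracGraph.isFractionalCovered_of_cut_condition _ k hk fun S T hST hx => ?_
  have key := FracGraph.induce_compl_cut_condition G k hk hn ?_ I hI S T hST ?_
  · convert key
  · convert hbind.lt using 1
    push_cast [Nat.cast_sub (show 1 ≤ 3 * k by omega),
      Nat.cast_sub (show 1 ≤ Fintype.card V by omega),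
      Nat.cast_sub (show 2 ≤ Fintype.card V by omega)]
    congr 1
    ring
  · convert hx
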